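/- Let $q\ge 2$ be an integer, and let real coefficients $\alpha_1,\dots,\alpha_q$, $\hat\alpha_1,\dots,\hat\alpha_q$, $\beta_1,\dots,\beta_{q-1}$, $\hat\beta_1,\dots,\hat\beta_{q-1}$, $\hat d_1,\dots,\hat d_{q-1}$ be given. Set $\alpha_k=\hat\alpha_k=\beta_k=\hat\beta_k=\hat d_k=0$ for $k\le 0$, and $\hat d_q=0$. Consider the $(q+1)$-stage implicit-explicit Runge–Kutta method for $\dot x=n(x,t)+s(x,t)$ that makes one step of size $h>0$ from $(t_0,x_0)$ to $x_1$ as follows. Its stages $g_0,\dots,g_q$ satisfy $g_0=x_0$, $$g_1=x_0+h\bigl(\alpha_1 n_0+\hat\alpha_1 s_0+\hat d_1 s_1\bigr),$$ $$g_j=x_0+h\bigl(\beta_{j-1}n_0+\alpha_j n_{j-1}+\hat\beta_{j-1}s_0+\hat\alpha_j s_{j-1}+\hat d_j s_j\bigr),\qquad 2\le j\le q,$$ and $$x_1=x_0+h\bigl(\beta_{q-1}n_0+\alpha_q n_{q-1}+\hat\beta_{q-1}s_0+\hat\alpha_q s_{q-1}\bigr),$$ where $n_k=n(g_k,t_0+c_kh)$,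 $s_k=s(g_k,t_0+\hat c_kh)$, $c_0=\hat c_0=0$, and $c_j=\alpha_j+\beta_{j-1}$, $\hat c_j=\hat\alpha_j+\hat d_j+\hat\beta_{j-1}$ for $1\le j\le q$. The method is called $p$-th order accurate if for every $d$, all smooth $n,s:\mathbb R^d\times\mathbb R\to\mathbb R^d$ and every solution $x$ of $\dot x=n(x,t)+s(x,t)$ near a time $t_0$, one step from $x_0=x(t_0)$ satisfies $x_1-x(t_0+h)=O(h^{p+1})$ as $h\to0^+$, where the stages are solutions of the stage equations that tend to $x_0$ as $h\to0^+$. **(1)** The method is second-order accurate if and only if $$\left\{\begin{array}{l} \alpha_q(\beta_{q-2}+\alpha_{q-1})=\alpha_q(\hat\beta_{q-2}+\hat\alpha_{q-1}+\hat d_{q-1})=\tfrac12,\\ \hat\alpha_q(\hat\beta_{q-2}+\hat\alpha_{q-1}+\hat d_{q-1})=\hat\alpha_q(\beta_{q-2}+\alpha_{q-1})=\tfrac12,\\ \alpha_q+\beta_{q-1}=1=\hat\alpha_q+\hat\beta_{q-1}. \end{array}\right.$$ If $\beta_{q-1}=\hat\beta_{q-1}=\beta_{q-2}=\hat\beta_{q-2}=0$,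 then this system is equivalent to $\alpha_q=1=\hat\alpha_q$, $\alpha_{q-1}=\tfrac12$ and $\hat\alpha_{q-1}+\hat d_{q-1}=\tfrac12$. **(2)** The method is third-order accurate if and only if $\alpha_q=\tfrac34=\hat\alpha_q$, $\beta_{q-1}=\tfrac14=\hat\beta_{q-1}$ and $$\left\{\begin{array}{l} \hat\alpha_{q-1}(\hat\alpha_{q-2}+\hat d_{q-2}+\hat\beta_{q-3})+\tfrac23\hat d_{q-1}=\tfrac29,\\ \hat\alpha_{q-1}(\alpha_{q-2}+\beta_{q-3})+\tfrac23\hat d_{q-1}=\tfrac29,\\ \alpha_{q-1}(\hat\alpha_{q-2}+\hat d_{q-2}+\hat\beta_{q-3})=\tfrac29=\alpha_{q-1}(\alpha_{q-2}+\beta_{q-3}),\\ \hat\alpha_{q-1}+\hat d_{q-1}+\hat\beta_{q-2}=\tfrac23=\alpha_{q-1}+\beta_{q-2}. \end{array}\right.$$ -/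

import Mathlib

open Filter Topology
open scoped ContDiff

/-- The data of an `r`-stage implicit-explicit Runge-Kutta method, that is, a double Butcher
tableau: `A, b, c` is the explicit method and `Ahat, bhat, chat` the (diagonally) implicit one.
`A` is strictly lower triangular and `Ahat` is lower triangular. -/
structure IMEXMethod (r : ℕ) where
  A : Matrix (Fin r) (Fin r) ℝ
  Ahat : Matrix (Fin r) (Fin r) ℝ
  b : Fin r → ℝ
  bhat : Fin r → ℝ
  c : Fin r → ℝ
  chat : Fin r → ℝ
  A_strictLower : ∀ j k, j ≤ k → A j k = 0
  Ahat_lower : ∀ j k, j < k → Ahat j k = 0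

namespace IMEXMethod

variable {r : ℕ} (M : IMEXMethod r) {E : Type*} [NormedAddCommGroup E] [NormedSpace ℝ E]

/-- `g` is a vector of internal stages for one step of size `h` from `x₀` at time `t₀`, for the
partitioned equation `x' = n (x, t) + s (x, t)`:
`g j = x₀ + h ∑ k < j, (A j k • n_k + Ahat j k • s_k) + h Ahat j j • s_j`, where
`n_k = n (g k, t₀ + c k h)` and `s_k = s (g k, t₀ + chat k h)`.
By triangularity of `A` and `Ahat` the sum may be extended over all `k`. -/
def IsStages (n s : E × ℝ → E) (t₀ : ℝ) (x₀ : E) (h : ℝ) (g : Fin r → E) : Prop :=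
  ∀ j, g j = x₀ + h • ∑ k, (M.A j k • n (g k, t₀ + M.c k * h)
    + M.Ahat j k • s (g k, t₀ + M.chat k * h))

/-- The value `x₁ = x₀ + h ∑ k, (b k • n_k + bhat k • s_k)` after one step with stages `g`. -/
def step (n s : E × ℝ → E) (t₀ : ℝ) (x₀ : E) (h : ℝ) (g : Fin r → E) : E :=
  x₀ + h • ∑ k, (M.b k • n (g k, t₀ + M.c k * h) + M.bhat k • s (g k, t₀ + M.chat k * h))

/-- The method is accurate of order `p` (at least): for every dimension `d`, all smooth
`n, s : ℝᵈ × ℝ → ℝᵈ` and every local solution `x` of `x' = n (x, t) + s (x, t)` around `t₀`, the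
error after one step of size `h` from the exact value `x t₀` is `O(h ^ (p + 1))` as `h → 0⁺`.
As the stage equations are implicit, the stages are those of a family `g h` of solutions of these
equations that tends to `x t₀` as `h → 0⁺`; by the implicit function theorem such a family exists,
and any two agree for all small `h > 0`. -/
def HasOrder (p : ℕ) : Prop :=
  ∀ (d : ℕ) (n s : EuclideanSpace ℝ (Fin d) × ℝ → EuclideanSpace ℝ (Fin d)),
    ContDiff ℝ ∞ n → ContDiff ℝ ∞ s →
    ∀ (t₀ : ℝ) (x : ℝ → EuclideanSpace ℝ (Fin d)),
      (∀ᶠ t in 𝓝 t₀, HasDerivAt x (n (x t, t) + s (x t, t)) t) →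
      ∀ g : ℝ → Fin r → EuclideanSpace ℝ (Fin d),
        (∀ j, Tendsto (fun h => g h j) (𝓝[>] 0) (𝓝 (x t₀))) →
        (∀ᶠ h in 𝓝[>] (0 : ℝ), M.IsStages n s t₀ (x t₀) h (g h)) →
        (fun h => M.step n s t₀ (x t₀) h (g h) - x (t₀ + h))
          =O[𝓝[>] 0] fun h => h ^ (p + 1)

end IMEXMethod

/-- The `k`-th entry, numbered from `1` to `m`, of a vector of length `m`; it is `0` for every
integer `k` outside this range. -/
def entry {m : ℕ} (v : Fin m → ℝ) (k : ℤ) : ℝ :=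
  if h : 1 ≤ k ∧ k ≤ m then v ⟨(k - 1).toNat, by omega⟩ else 0

/-- The coefficients `α, α̂ ∈ ℝ^q`, `β, β̂, d̂ ∈ ℝ^(q-1)` of a member of the family. -/
structure IMEXCoeffs (q : ℕ) where
  α : Fin q → ℝ
  αhat : Fin q → ℝ
  β : Fin (q - 1) → ℝ
  βhat : Fin (q - 1) → ℝ
  dhat : Fin (q - 1) → ℝ

namespace IMEXCoeffs

variable {q : ℕ} (C : IMEXCoeffs q)

/-- The explicit matrix, with rows and columns `0, …, q`: `α_j` below the diagonal in row `j ≥ 1`,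
and `β_{j-1}` in the first column of row `j ≥ 2`. -/
def A : Matrix (Fin (q + 1)) (Fin (q + 1)) ℝ := fun j k =>
  if (k : ℕ) + 1 = j then entry C.α j
  else if (k : ℕ) = 0 then entry C.β ((j : ℤ) - 1)
  else 0

/-- The implicit matrix, with rows and columns `0, …, q`: `d̂_j` on the diagonal in rows
`1, …, q - 1` (and `0` in rows `0` and `q`), `α̂_j` below the diagonal in row `j ≥ 1`, and
`β̂_{j-1}` in the first column of row `j ≥ 2`. -/
def Ahat : Matrix (Fin (q + 1)) (Fin (q + 1)) ℝ := fun j k =>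
  if (k : ℕ) = j then entry C.dhat j
  else if (k : ℕ) + 1 = j then entry C.αhat j
  else if (k : ℕ) = 0 then entry C.βhat ((j : ℤ) - 1)
  else 0

/-- The FSAL `(q + 1)`-stage method with these coefficients: `b` and `bhat` are the last rows of
the matrices, `c` and `chat` are the row sums. -/
def toMethod : IMEXMethod (q + 1) where
  A := C.A
  Ahat := C.Ahat
  b := C.A (Fin.last q)
  bhat := C.Ahat (Fin.last q)
  c := fun j => ∑ k, C.A j k
  chat := fun j => ∑ k, C.Ahat j k
  A_strictLower := by
    intro j k hjk
    have hjk' : (j : ℕ) ≤ k := hjk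
    unfold A
    rw [if_neg (by omega)]
    split_ifs with h0
    · unfold entry
      rw [dif_neg (by omega)]
    · rfl
  Ahat_lower := by
    intro j k hjk
    have hjk' : (j : ℕ) < k := hjk
    unfold Ahat
    rw [if_neg (by omega), if_neg (by omega), if_neg (by omega)]

end IMEXCoeffs

/-! Sufficiency rests on the last row: only stages `0` and `q - 1` can carry explicit weight, and
the conditions force the explicit and implicit weights to agree, as do the nodes of the weighted
stages. The step is then a single quadrature rule applied to `n + s`. If the rule is exact in degree
less than `p` and every weighted stage is within `O(h ^ p)` of the solution at its node, the local
error is `O(h ^ (p + 1))` (`step_sub_isBigO`). For `p = 2` the rule needs only the first two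
moments, and consistency of the row sums handles the stages. For `p = 3` it is the Radau rule with
weights `1/4, 3/4` at `0, 2/3`, and the remaining conditions say that stage `q - 1` is correct to
second order for each pairing of the two methods.

Necessity uses one family of test problems on `ℝ⁴`. The field is triangular, so solution and stages
are explicit polynomials in `h`. Each component is split between `n` and `s` by a weight vector `w`;
comparing coefficients of `h`, `h ^ 2`, `h ^ 3` for suitable `w` yields every order condition that
is needed (`HasOrder.conditions`). The theorem is then algebra with the few nonzero entries of the
last rows. -/

open Asymptotics

/-! ### Taylor expansion, quadrature error and smoothness of solutions -/

section Analysis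

variable {E F : Type*} [NormedAddCommGroup E] [NormedSpace ℝ E]
  [NormedAddCommGroup F] [NormedSpace ℝ F]

/-- Taylor's theorem at an interior point, with the remainder in `O`-form. -/
theorem ContDiffAt.taylor_isBigO {f : ℝ → E} {a : ℝ} {m : ℕ} (hf : ContDiffAt ℝ m f a) :
    (fun h => f (a + h) - ∑ i ∈ Finset.range m, (h ^ i / i.factorial) • iteratedDeriv i f a)
      =O[𝓝 0] fun h => h ^ m := by
  obtain ⟨u, hu, hfu⟩ := hf.contDiffOn le_rfl (by simp)
  obtain ⟨ε, hε, hball⟩ := Metric.mem_nhds_iff.1 hu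
  have ha : a ∈ Metric.ball a ε := Metric.mem_ball_self hε
  have key := (taylor_isLittleO (convex_ball a ε) ha (hfu.mono hball)).isBigO
  rw [Metric.isOpen_ball.nhdsWithin_eq ha] at key
  have hlim : Tendsto (fun h : ℝ => a + h) (𝓝 0) (𝓝 a) := Continuous.tendsto' (by fun_prop) _ _ (by simp)
  have key := key.comp_tendsto hlim
  -- The little-o estimate includes the term of degree `m`; that term is itself `O(h ^ m)` and can
  -- be dropped from the polynomial.
  have hlast : (fun h : ℝ => (h ^ m / m.factorial) • iteratedDeriv m f a)
      =O[𝓝 0] fun h => h ^ m := by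
    refine IsBigO.of_bound (‖((m.factorial : ℝ)⁻¹) • iteratedDeriv m f a‖) (.of_forall fun h => ?_)
    rw [div_eq_mul_inv, mul_smul, norm_smul, mul_comm]
  refine ((key.congr_right fun h => by simp).add hlast).congr_left fun h => ?_
  simp only [Function.comp, taylor_within_apply, Finset.sum_range_succ, add_sub_cancel_left,
    iteratedDerivWithin_of_isOpen Metric.isOpen_ball ha]
  simp only [div_eq_inv_mul]
  abel

theorem ContDiffAt.taylor_mul_isBigO {f : ℝ → E} {a : ℝ} {m : ℕ} (hf : ContDiffAt ℝ m f a)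
    (c : ℝ) :
    (fun h => f (a + c * h)
      - ∑ i ∈ Finset.range m, ((c * h) ^ i / i.factorial) • iteratedDeriv i f a)
      =O[𝓝 0] fun h => h ^ m := by
  have hlim : Tendsto (fun h : ℝ => c * h) (𝓝 0) (𝓝 0) :=
    Continuous.tendsto' (by fun_prop) _ _ (by simp)
  refine (hf.taylor_isBigO.comp_tendsto hlim).trans ?_
  exact IsBigO.of_bound (|c| ^ m) (.of_forall fun h => by simp [mul_pow])

/-- A quadrature formula with nodes `c` and weights `b` that is exact for polynomials of degree
less than `p` has local error `O(h ^ (p + 1))`. -/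
theorem ContDiffAt.quadrature_isBigO {ι : Type*} [Fintype ι] {f : ℝ → E} {a : ℝ} {p : ℕ}
    (hf : ContDiffAt ℝ (p + 1 : ℕ) f a) (b c : ι → ℝ)
    (hbc : ∀ i < p, ∑ k, b k * c k ^ i = 1 / (i + 1)) :
    (fun h => f (a + h) - f a - h • ∑ k, b k • deriv f (a + c k * h))
      =O[𝓝 0] fun h => h ^ (p + 1) := by
  have hd : ContDiffAt ℝ p (deriv f) a := hf.derivWithin (by simp)
  have hnode := fun k => hd.taylor_mul_isBigO (c k)
  have hsum := (isBigO_refl (fun h : ℝ => h) (𝓝 0)).smul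
    (IsBigO.sum (s := Finset.univ) fun k _ => (hnode k).const_smul_left (b k))
  have hX := hf.taylor_isBigO
  refine (hX.sub (hsum.congr_right fun h => by rw [smul_eq_mul, ← pow_succ'])).congr_left
    fun h => ?_
  have hquad : h • ∑ k, b k • ∑ i ∈ Finset.range p,
      ((c k * h) ^ i / i.factorial) • iteratedDeriv i (deriv f) a
      = ∑ i ∈ Finset.range p, (h ^ (i + 1) / (i + 1).factorial) • iteratedDeriv (i + 1) f a := by
    simp only [Finset.smul_sum, smul_smul]
    rw [Finset.sum_comm]
    refine Finset.sum_congr rfl fun i hi => ?_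
    rw [iteratedDeriv_succ', ← Finset.sum_smul]
    congr 1
    have := hbc i (Finset.mem_range.1 hi)
    calc ∑ k, h * (b k * ((c k * h) ^ i / i.factorial))
        = (h ^ (i + 1) / i.factorial) * ∑ k, b k * c k ^ i := by
          rw [Finset.mul_sum]
          exact Finset.sum_congr rfl fun k _ => by rw [mul_pow]; ring
      _ = _ := by
          rw [this, Nat.factorial_succ]
          push_cast
          field_simp
  simp only [Finset.sum_apply, Pi.smul_apply, smul_sub, Finset.sum_sub_distrib]
  rw [hquad, Finset.sum_range_succ' _ p]
  simp only [pow_zero, iteratedDeriv_zero, Nat.factorial_zero, Nat.cast_one, div_one, one_smul]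
  module

/-- A solution of a smooth differential equation is smooth. -/
theorem contDiffAt_of_hasDerivAt_comp {f : E × ℝ → E} (hf : ContDiff ℝ ∞ f) {x : ℝ → E} {t₀ : ℝ}
    (hx : ∀ᶠ t in 𝓝 t₀, HasDerivAt x (f (x t, t)) t) (m : ℕ) : ContDiffAt ℝ m x t₀ := by
  obtain ⟨ε, hε, hball⟩ := Metric.eventually_nhds_iff_ball.1 hx
  -- A ball independent of `m` lets the bootstrap `x' = f (x, t)` run as an induction without
  -- shrinking neighbourhoods.
  suffices H : ContDiffOn ℝ m x (Metric.ball t₀ ε) from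
    H.contDiffAt (Metric.ball_mem_nhds t₀ hε)
  induction m with
  | zero =>
    exact contDiffOn_zero.2 fun t ht => (hball t ht).continuousAt.continuousWithinAt
  | succ m ih =>
    push_cast
    rw [contDiffOn_succ_iff_deriv_of_isOpen Metric.isOpen_ball]
    refine ⟨fun t ht => (hball t ht).differentiableAt.differentiableWithinAt, by simp, ?_⟩
    have : ContDiffOn ℝ m (fun t => f (x t, t)) (Metric.ball t₀ ε) :=
      (hf.of_le (by exact_mod_cast le_top)).comp_contDiffOn (ih.prodMk contDiffOn_id)
    exact this.congr fun t ht => (hball t ht).deriv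

/-- The quadratic bound for the remainder of the first-order expansion of a `C²` function. -/
theorem ContDiff.sub_fderiv_isBigO_sq {f : E → F} (hf : ContDiff ℝ 2 f) (a : E) :
    (fun z => f z - f a - fderiv ℝ f a (z - a)) =O[𝓝 a] fun z => ‖z - a‖ ^ 2 := by
  have hdf : Differentiable ℝ f := hf.differentiable (by norm_num)
  have hdd : Differentiable ℝ (fderiv ℝ f) :=
    (hf.fderiv_right (m := 1) (by norm_num)).differentiable (by norm_num)
  have hderiv : ∀ z, fderiv ℝ (fun z => f z - fderiv ℝ f a z) z = fderiv ℝ f z - fderiv ℝ f a :=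
    fun z => by
      rw [fderiv_fun_sub (hdf z) (fderiv ℝ f a).differentiableAt, ContinuousLinearMap.fderiv]
  -- Mean value estimate for `f` minus its linear part, whose derivative is `O(‖z - a‖)`.
  have key := sub_isBigO_norm_rpow_add_one_of_fderiv (f := fun z => f z - fderiv ℝ f a z)
    (a := a) (r := 1) zero_le_one
    (.of_forall fun z => (hdf z).sub (fderiv ℝ f a).differentiableAt)
    (by
      simp only [Real.rpow_one]
      exact ((hdd a).isBigO_sub.congr_left fun z => (hderiv z).symm).norm_right)
  refine (key.congr_left fun z => ?_).congr_right fun z => ?_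
  · rw [map_sub]; abel
  · norm_num

end Analysis

/-! ### Expansion of a field along a stage -/

section Nodes

variable {E F : Type*} [NormedAddCommGroup E] [NormedAddCommGroup F] {y : ℝ → E} {x₀ : E}

theorem tendsto_prodMk_add_mul (t₀ c : ℝ) (hy : Tendsto y (𝓝[>] 0) (𝓝 x₀)) :
    Tendsto (fun h => (y h, t₀ + c * h)) (𝓝[>] 0) (𝓝 (x₀, t₀)) :=
  hy.prodMk_nhds ((Continuous.tendsto' (by fun_prop) _ _ (by simp)).mono_left nhdsWithin_le_nhds)

theorem tendsto_of_sub_isBigO (hy : (fun h => y h - x₀) =O[𝓝[>] 0] fun h => h) :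
    Tendsto y (𝓝[>] 0) (𝓝 x₀) :=
  tendsto_sub_nhds_zero_iff.1 <|
    hy.trans_tendsto (tendsto_id.mono_left nhdsWithin_le_nhds)

theorem prodMk_sub_isBigO (t₀ c : ℝ) (hy : (fun h => y h - x₀) =O[𝓝[>] 0] fun h => h) :
    (fun h => (y h, t₀ + c * h) - (x₀, t₀)) =O[𝓝[>] 0] fun h => h := by
  refine (hy.prod_left ((isBigO_refl (fun h : ℝ => h) _).const_mul_left c)).congr_left fun h => ?_
  simp

variable [NormedSpace ℝ E] [NormedSpace ℝ F]

theorem ContDiff.comp_sub_isBigO {f : E × ℝ → F} (hf : ContDiff ℝ 2 f) (t₀ c : ℝ)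
    (hy : (fun h => y h - x₀) =O[𝓝[>] 0] fun h => h) :
    (fun h => f (y h, t₀ + c * h) - f (x₀, t₀)) =O[𝓝[>] 0] fun h => h :=
  ((hf.differentiable (by norm_num) (x₀, t₀)).isBigO_sub.comp_tendsto
    (tendsto_prodMk_add_mul t₀ c (tendsto_of_sub_isBigO hy))).trans (prodMk_sub_isBigO t₀ c hy)

theorem ContDiff.comp_sub_fderiv_isBigO {f : E × ℝ → F} (hf : ContDiff ℝ 2 f) (t₀ c : ℝ) {u : E}
    (hy : (fun h => y h - x₀) =O[𝓝[>] 0] fun h => h)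
    (hyu : (fun h => y h - x₀ - h • u) =O[𝓝[>] 0] fun h => h ^ 2) :
    (fun h => f (y h, t₀ + c * h) - (f (x₀, t₀) + h • fderiv ℝ f (x₀, t₀) (u, c)))
      =O[𝓝[>] 0] fun h => h ^ 2 := by
  have h1 := (hf.sub_fderiv_isBigO_sq (x₀, t₀)).comp_tendsto
    (tendsto_prodMk_add_mul t₀ c (tendsto_of_sub_isBigO hy))
  have h2 := h1.trans ((prodMk_sub_isBigO t₀ c hy).norm_left.pow 2)
  have h3 : (fun h => fderiv ℝ f (x₀, t₀) (y h - x₀ - h • u, 0)) =O[𝓝[>] 0] fun h => h ^ 2 :=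
    ((fderiv ℝ f (x₀, t₀)).isBigO_comp _ _).trans (hyu.prod_left (isBigO_zero _ _))
  refine (h2.add h3).congr_left fun h => ?_
  have : ((y h, t₀ + c * h) : E × ℝ) - (x₀, t₀) = (y h - x₀ - h • u, 0) + h • (u, c) := by
    ext <;> simp [mul_comm]
  simp only [Function.comp, this, map_add, map_smul]
  abel

end Nodes

/-! ### Perturbation of increments -/

section Sums

variable {E : Type*} [NormedAddCommGroup E] [NormedSpace ℝ E] {ι : Type*} [Fintype ι]

/-- Replacing the slopes by approximations of order `m` changes an increment by
`O(h ^ (m + 1))`. -/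
theorem increment_sub_isBigO {l : Filter ℝ} {m : ℕ} (a a' : ι → ℝ) {N P S Q : ι → ℝ → E}
    (hN : ∀ k, a k ≠ 0 → (fun h => N k h - P k h) =O[l] fun h => h ^ m)
    (hS : ∀ k, a' k ≠ 0 → (fun h => S k h - Q k h) =O[l] fun h => h ^ m) :
    (fun h => h • ∑ k, (a k • N k h + a' k • S k h) - h • ∑ k, (a k • P k h + a' k • Q k h))
      =O[l] fun h => h ^ (m + 1) := by
  have hterm : ∀ k, (fun h => a k • (N k h - P k h) + a' k • (S k h - Q k h))
      =O[l] fun h => h ^ m := by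
    intro k
    refine IsBigO.add ?_ ?_
    -- Slopes with zero coefficient need no approximation, so inaccurate stages of zero weight do no
    -- harm.
    · by_cases hk : a k = 0
      · simpa [hk] using isBigO_zero _ _
      · exact (hN k hk).const_smul_left _
    · by_cases hk : a' k = 0
      · simpa [hk] using isBigO_zero _ _
      · exact (hS k hk).const_smul_left _
  refine (((isBigO_refl (fun h : ℝ => h) l).smul
    (IsBigO.fun_sum (s := Finset.univ) fun k _ => hterm k)).congr_left fun h => ?_).congr_right
    fun h => by rw [smul_eq_mul, pow_succ']
  rw [← smul_sub, ← Finset.sum_sub_distrib]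
  exact congrArg _ (Finset.sum_congr rfl fun k _ => by module)

end Sums

/-! ### Stage expansions and sufficient conditions for a general tableau -/

namespace IMEXMethod

variable {r : ℕ} {M : IMEXMethod r} {E : Type*} [NormedAddCommGroup E] [NormedSpace ℝ E]
  {n s : E × ℝ → E} {t₀ : ℝ} {x₀ : E} {g : ℝ → Fin r → E}

/-- The bootstrap: the factor `h` in the stage equation turns slopes known to order `m` into stages
known to order `m + 1`. It treats implicit stages like explicit ones, since convergence of the
stages supplies the start `m = 0`. -/
theorem stage_sub_isBigO (hst : ∀ᶠ h in 𝓝[>] (0 : ℝ), M.IsStages n s t₀ x₀ h (g h)) {m : ℕ}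
    {P Q : Fin r → ℝ → E} (j : Fin r)
    (hP : ∀ k, (fun h => n (g h k, t₀ + M.c k * h) - P k h) =O[𝓝[>] 0] fun h => h ^ m)
    (hQ : ∀ k, (fun h => s (g h k, t₀ + M.chat k * h) - Q k h) =O[𝓝[>] 0] fun h => h ^ m) :
    (fun h => g h j - x₀ - h • ∑ k, (M.A j k • P k h + M.Ahat j k • Q k h))
      =O[𝓝[>] 0] fun h => h ^ (m + 1) := by
  refine (increment_sub_isBigO (fun k => M.A j k) (fun k => M.Ahat j k) (fun k _ => hP k) (fun k _ => hQ k)).congr' ?_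
    .rfl
  filter_upwards [hst] with h hh
  rw [sub_left_inj, eq_sub_iff_add_eq']
  exact (hh j).symm

theorem stage_sub_isBigO_one (hn : Continuous n) (hs : Continuous s)
    (hg : ∀ j, Tendsto (fun h => g h j) (𝓝[>] 0) (𝓝 x₀))
    (hst : ∀ᶠ h in 𝓝[>] (0 : ℝ), M.IsStages n s t₀ x₀ h (g h)) (j : Fin r) :
    (fun h => g h j - x₀) =O[𝓝[>] 0] fun h => h := by
  have hbdd : ∀ {f : E × ℝ → E}, Continuous f → ∀ (k : Fin r) (c : ℝ),
      (fun h => f (g h k, t₀ + c * h) - 0) =O[𝓝[>] 0] fun h => h ^ 0 := by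
    intro f hf k c
    simpa using ((hf.tendsto _).comp (tendsto_prodMk_add_mul t₀ c (hg k))).isBigO_one ℝ
  simpa using stage_sub_isBigO hst (P := fun _ _ => 0) (Q := fun _ _ => 0) j
    (fun k => hbdd hn k _) (fun k => hbdd hs k _)

theorem stage_sub_isBigO_two (hn : ContDiff ℝ 2 n) (hs : ContDiff ℝ 2 s)
    (hc : ∀ j, M.c j = ∑ k, M.A j k) (hchat : ∀ j, M.chat j = ∑ k, M.Ahat j k)
    (hg : ∀ j, Tendsto (fun h => g h j) (𝓝[>] 0) (𝓝 x₀))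
    (hst : ∀ᶠ h in 𝓝[>] (0 : ℝ), M.IsStages n s t₀ x₀ h (g h)) (j : Fin r) :
    (fun h => g h j - x₀ - h • (M.c j • n (x₀, t₀) + M.chat j • s (x₀, t₀)))
      =O[𝓝[>] 0] fun h => h ^ 2 := by
  have h1 := stage_sub_isBigO_one hn.continuous hs.continuous hg hst
  refine (stage_sub_isBigO hst (m := 1) (P := fun _ _ => n (x₀, t₀)) (Q := fun _ _ => s (x₀, t₀)) j
    (fun k => ?_) (fun k => ?_)).congr_left fun h => ?_
  · simpa using hn.comp_sub_isBigO t₀ (M.c k) (h1 k)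
  · simpa using hs.comp_sub_isBigO t₀ (M.chat k) (h1 k)
  · rw [Finset.sum_add_distrib, ← Finset.sum_smul, ← Finset.sum_smul, hc, hchat]

/-- The second-order expansion of the internal stages, in the case where the `j`-th row is
consistent to second order. -/
theorem stage_sub_isBigO_three (hn : ContDiff ℝ 2 n) (hs : ContDiff ℝ 2 s)
    (hc : ∀ j, M.c j = ∑ k, M.A j k) (hchat : ∀ j, M.chat j = ∑ k, M.Ahat j k)
    (hg : ∀ j, Tendsto (fun h => g h j) (𝓝[>] 0) (𝓝 x₀))
    (hst : ∀ᶠ h in 𝓝[>] (0 : ℝ), M.IsStages n s t₀ x₀ h (g h)) (j : Fin r)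
    (hcc : M.chat j = M.c j) (h11 : ∑ k, M.A j k * M.c k = M.c j ^ 2 / 2)
    (h12 : ∑ k, M.A j k * M.chat k = M.c j ^ 2 / 2)
    (h21 : ∑ k, M.Ahat j k * M.c k = M.c j ^ 2 / 2)
    (h22 : ∑ k, M.Ahat j k * M.chat k = M.c j ^ 2 / 2) :
    (fun h => g h j - (x₀ + (M.c j * h) • (n (x₀, t₀) + s (x₀, t₀)) + ((M.c j * h) ^ 2 / 2) •
        fderiv ℝ (fun z => n z + s z) (x₀, t₀) (n (x₀, t₀) + s (x₀, t₀), 1)))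
      =O[𝓝[>] 0] fun h => h ^ 3 := by
  have h1 := stage_sub_isBigO_one hn.continuous hs.continuous hg hst
  have h2 := stage_sub_isBigO_two hn hs hc hchat hg hst
  refine (stage_sub_isBigO hst (m := 2) j
    (fun k => hn.comp_sub_fderiv_isBigO t₀ (M.c k) (h1 k) (h2 k))
    (fun k => hs.comp_sub_fderiv_isBigO t₀ (M.chat k) (h1 k) (h2 k))).congr_left fun h => ?_
  -- The stage moves along `c • n + chat • s`, while time advances by `c` in `n` and by `chat` in
  -- `s`. Hence the time component is grouped with `n` here and with `s` in `hdir'`.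
  have hdir : ∀ (L : E × ℝ →L[ℝ] E) (a b : ℝ) (u v : E),
      L (a • u + b • v, a) = a • L (u, 1) + b • L (v, 0) := fun L a b u v => by
    rw [← map_smul, ← map_smul, ← map_add]
    simp
  have hdir' : ∀ (L : E × ℝ →L[ℝ] E) (a b : ℝ) (u v : E),
      L (a • u + b • v, b) = a • L (u, 0) + b • L (v, 1) := fun L a b u v => by
    rw [← map_smul, ← map_smul, ← map_add]
    simp
  have hsplit : ∀ (w : Fin r → ℝ) (e f₁ f₂ : E),
      ∑ k, w k • (e + h • (M.c k • f₁ + M.chat k • f₂))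
        = (∑ k, w k) • e + (h * ∑ k, w k * M.c k) • f₁ + (h * ∑ k, w k * M.chat k) • f₂ := by
    intro w e f₁ f₂
    simp only [Finset.mul_sum, Finset.sum_smul, ← Finset.sum_add_distrib]
    exact Finset.sum_congr rfl fun k _ => by module
  have hD : fderiv ℝ (fun z => n z + s z) (x₀, t₀) = fderiv ℝ n (x₀, t₀) + fderiv ℝ s (x₀, t₀) :=
    fderiv_fun_add (hn.differentiable (by norm_num) _) (hs.differentiable (by norm_num) _)
  have hUn : fderiv ℝ n (x₀, t₀) (n (x₀, t₀) + s (x₀, t₀), 1)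
      = fderiv ℝ n (x₀, t₀) (n (x₀, t₀), 1) + fderiv ℝ n (x₀, t₀) (s (x₀, t₀), 0) := by
    simpa using hdir (fderiv ℝ n (x₀, t₀)) 1 1 (n (x₀, t₀)) (s (x₀, t₀))
  have hUs : fderiv ℝ s (x₀, t₀) (n (x₀, t₀) + s (x₀, t₀), 1)
      = fderiv ℝ s (x₀, t₀) (n (x₀, t₀), 0) + fderiv ℝ s (x₀, t₀) (s (x₀, t₀), 1) := by
    simpa using hdir' (fderiv ℝ s (x₀, t₀)) 1 1 (n (x₀, t₀)) (s (x₀, t₀))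
  rw [Finset.sum_add_distrib]
  simp only [hdir, hdir']
  -- All four pairings of derivative and direction get the same coefficient `c ^ 2 / 2`, so they
  -- combine into the derivative of `n + s` along the solution.
  rw [hsplit, hsplit, ← hc, ← hchat, h11, h12, h21, h22, hcc, hD, add_apply,
    hUn, hUs]
  module

/-- If both weight vectors agree and form a quadrature formula of order `p`, and if all stages of
nonzero weight approximate the solution at their node to order `p`, then the step is accurate of
order `p`. -/
theorem step_sub_isBigO {p : ℕ} {x : ℝ → E} (hn : ContDiff ℝ ∞ n) (hs : ContDiff ℝ ∞ s)
    (hx : ∀ᶠ t in 𝓝 t₀, HasDerivAt x (n (x t, t) + s (x t, t)) t)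
    (hb : M.bhat = M.b) (hbc : ∀ i < p, ∑ k, M.b k * M.c k ^ i = 1 / (i + 1))
    (hcc : ∀ k, M.b k ≠ 0 → M.chat k = M.c k)
    (hg : ∀ j, Tendsto (fun h => g h j) (𝓝[>] 0) (𝓝 (x t₀)))
    (hstage : ∀ k, M.b k ≠ 0 → (fun h => g h k - x (t₀ + M.c k * h)) =O[𝓝[>] 0] fun h => h ^ p) :
    (fun h => M.step n s t₀ (x t₀) h (g h) - x (t₀ + h)) =O[𝓝[>] 0] fun h => h ^ (p + 1) := by
  have hnode : ∀ c : ℝ, Tendsto (fun h : ℝ => t₀ + c * h) (𝓝[>] 0) (𝓝 t₀) := fun c =>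
    (Continuous.tendsto' (by fun_prop) _ _ (by simp)).mono_left nhdsWithin_le_nhds
  have hxt : Tendsto x (𝓝 t₀) (𝓝 (x t₀)) := hx.self_of_nhds.continuousAt
  have hcomp : ∀ {f : E × ℝ → E}, ContDiff ℝ ∞ f → ∀ k, M.b k ≠ 0 →
      (fun h => f (g h k, t₀ + M.c k * h) - f (x (t₀ + M.c k * h), t₀ + M.c k * h))
        =O[𝓝[>] 0] fun h => h ^ p := by
    intro f hf k hk
    -- Strict differentiability gives a local Lipschitz bound between two moving points, here the
    -- stage and the exact solution.
    have hstrict : HasStrictFDerivAt f (fderiv ℝ f (x t₀, t₀)) (x t₀, t₀) :=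
      hf.contDiffAt.hasStrictFDerivAt (by simp)
    have h1 := tendsto_prodMk_add_mul t₀ (M.c k) (hg k)
    have h2 := tendsto_prodMk_add_mul t₀ (M.c k) (hxt.comp (hnode (M.c k)))
    have h3 := hstrict.isBigO_sub.comp_tendsto (h1.prodMk_nhds h2)
    refine h3.trans (((hstage k hk).prod_left (isBigO_zero _ _)).congr_left fun h => ?_)
    simp
  have hinc := increment_sub_isBigO M.b M.b
    (S := fun k h => s (g h k, t₀ + M.c k * h))
    (fun k hk => hcomp hn k hk) (fun k hk => hcomp hs k hk)
  have hsmooth := contDiffAt_of_hasDerivAt_comp (hn.add hs) hx (p + 1)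
  have hquad := (hsmooth.quadrature_isBigO M.b M.c hbc).mono (nhdsWithin_le_nhds (s := Set.Ioi 0))
  have hder : ∀ k, ∀ᶠ h : ℝ in 𝓝[>] 0, deriv x (t₀ + M.c k * h)
      = n (x (t₀ + M.c k * h), t₀ + M.c k * h) + s (x (t₀ + M.c k * h), t₀ + M.c k * h) := fun k =>
    ((hnode (M.c k)).eventually hx).mono fun h hh => hh.deriv
  refine (hinc.sub hquad).congr' ?_ .rfl
  filter_upwards [eventually_all.2 hder] with h hh
  have hstep : ∑ k, (M.b k • n (g h k, t₀ + M.c k * h) + M.bhat k • s (g h k, t₀ + M.chat k * h))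
      = ∑ k, (M.b k • n (g h k, t₀ + M.c k * h) + M.b k • s (g h k, t₀ + M.c k * h)) := by
    refine Finset.sum_congr rfl fun k _ => ?_
    by_cases hk : M.b k = 0
    · simp [hb, hk]
    · rw [hb, hcc k hk]
  rw [step, hstep]
  simp only [hh, smul_add]
  abel

/-- Sufficient conditions for second order. -/
theorem hasOrder_two (M : IMEXMethod r)
    (hc : ∀ j, M.c j = ∑ k, M.A j k) (hchat : ∀ j, M.chat j = ∑ k, M.Ahat j k)
    (hb : M.bhat = M.b) (hbc : ∀ i : ℕ, i < 2 → ∑ k, M.b k * M.c k ^ i = 1 / (i + 1))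
    (hcc : ∀ k, M.b k ≠ 0 → M.chat k = M.c k) : M.HasOrder 2 := by
  intro d n s hn hs t₀ x hx g hg hst
  refine step_sub_isBigO hn hs hx hb hbc hcc hg fun k hk => ?_
  have hn2 : ContDiff ℝ 2 n := mod_cast contDiff_infty.1 hn 2
  have hs2 : ContDiff ℝ 2 s := mod_cast contDiff_infty.1 hs 2
  have hX := ((contDiffAt_of_hasDerivAt_comp (hn.add hs) hx 2).taylor_mul_isBigO (M.c k)).mono
    (nhdsWithin_le_nhds (s := Set.Ioi 0))
  refine ((stage_sub_isBigO_two hn2 hs2 hc hchat hg hst k).sub hX).congr_left fun h => ?_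
  simp only [Finset.sum_range_succ, Finset.sum_range_zero, iteratedDeriv_zero,
    iteratedDeriv_one, hx.self_of_nhds.deriv, hcc k hk, Nat.factorial, Nat.cast_one, div_one,
    pow_zero, pow_one, Nat.mul_one]
  module

/-- Sufficient conditions for third order. -/
theorem hasOrder_three (M : IMEXMethod r)
    (hc : ∀ j, M.c j = ∑ k, M.A j k) (hchat : ∀ j, M.chat j = ∑ k, M.Ahat j k)
    (hb : M.bhat = M.b) (hbc : ∀ i : ℕ, i < 3 → ∑ k, M.b k * M.c k ^ i = 1 / (i + 1))
    (hcc : ∀ k, M.b k ≠ 0 → M.chat k = M.c k)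
    (h11 : ∀ j, M.b j ≠ 0 → ∑ k, M.A j k * M.c k = M.c j ^ 2 / 2)
    (h12 : ∀ j, M.b j ≠ 0 → ∑ k, M.A j k * M.chat k = M.c j ^ 2 / 2)
    (h21 : ∀ j, M.b j ≠ 0 → ∑ k, M.Ahat j k * M.c k = M.c j ^ 2 / 2)
    (h22 : ∀ j, M.b j ≠ 0 → ∑ k, M.Ahat j k * M.chat k = M.c j ^ 2 / 2) : M.HasOrder 3 := by
  intro d n s hn hs t₀ x hx g hg hst
  refine step_sub_isBigO hn hs hx hb hbc hcc hg fun k hk => ?_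
  have hn2 : ContDiff ℝ 2 n := mod_cast contDiff_infty.1 hn 2
  have hs2 : ContDiff ℝ 2 s := mod_cast contDiff_infty.1 hs 2
  have hX := ((contDiffAt_of_hasDerivAt_comp (hn.add hs) hx 3).taylor_mul_isBigO (M.c k)).mono
    (nhdsWithin_le_nhds (s := Set.Ioi 0))
  have hderiv2 : iteratedDeriv 2 x t₀ = fderiv ℝ (fun z => n z + s z) (x t₀, t₀)
      (n (x t₀, t₀) + s (x t₀, t₀), 1) := by
    have hF : HasFDerivAt (fun z => n z + s z) (fderiv ℝ (fun z => n z + s z) (x t₀, t₀))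
        (x t₀, t₀) := ((hn2.add hs2).differentiable (by norm_num) _).hasFDerivAt
    have hcompd := hF.comp_hasDerivAt (f := fun t => (x t, t)) t₀ (hx.self_of_nhds.prodMk (hasDerivAt_id t₀))
    have heq : deriv x =ᶠ[𝓝 t₀] fun t => n (x t, t) + s (x t, t) := hx.mono fun t ht => ht.deriv
    rw [iteratedDeriv_succ, iteratedDeriv_one, heq.deriv_eq]
    exact hcompd.deriv
  refine ((stage_sub_isBigO_three hn2 hs2 hc hchat hg hst k (hcc k hk) (h11 k hk) (h12 k hk)
    (h21 k hk) (h22 k hk)).sub hX).congr_left fun h => ?_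
  simp only [Finset.sum_range_succ, Finset.sum_range_zero, iteratedDeriv_zero,
    iteratedDeriv_one, hderiv2, hx.self_of_nhds.deriv, Nat.factorial, Nat.cast_one, div_one,
    pow_zero, pow_one, Nat.mul_one]
  norm_num

end IMEXMethod

/-! ### Necessary conditions from a test problem -/

theorem eq_zero_of_pow_mul_isBigO {K : ℝ} {i p : ℕ} (hip : i ≤ p)
    (h : (fun h : ℝ => h ^ i * K) =O[𝓝[>] 0] fun h => h ^ (p + 1)) : K = 0 := by
  have h1 : (fun h : ℝ => h ^ (p + 1)) =O[𝓝[>] 0] fun h => h ^ i * h := by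
    obtain ⟨m, rfl⟩ := Nat.exists_eq_add_of_le hip
    have : (fun h : ℝ => h ^ m) =O[𝓝[>] 0] fun _ => (1 : ℝ) :=
      ((Continuous.tendsto (by fun_prop) 0).mono_left nhdsWithin_le_nhds).isBigO_one ℝ
    refine (((isBigO_refl (fun h : ℝ => h ^ i * h) _).mul this).congr_left fun h => by ring)
      |>.congr_right fun h => by ring
  have h2 : (fun _ : ℝ => K) =O[𝓝[>] 0] fun h => h := by
    refine ((isBigO_refl (fun h : ℝ => (h ^ i)⁻¹) _).mul (h.trans h1)).congr' ?_ ?_ <;>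
    · filter_upwards [self_mem_nhdsWithin] with h hh
      have : h ≠ 0 := ne_of_gt hh
      field_simp
  have h3 := h2.trans_tendsto (tendsto_id.mono_left nhdsWithin_le_nhds)
  exact tendsto_nhds_unique tendsto_const_nhds h3

namespace IMEXMethod

/-- A triangular vector field on `ℝ⁴` whose solution from the origin is
`(t, t² / 2, t³ / 6, t³ / 3)` when all entries of `w` are `1`. -/
noncomputable def chainField (w : Fin 4 → ℝ) (z : EuclideanSpace ℝ (Fin 4) × ℝ) :
    EuclideanSpace ℝ (Fin 4) :=
  !₂[w 0, w 1 * z.1 0, w 2 * z.1 1, w 3 * z.2 ^ 2]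

theorem contDiff_chainField (w : Fin 4 → ℝ) : ContDiff ℝ ∞ (chainField w) := by
  rw [contDiff_euclidean]
  have h : ∀ i, ContDiff ℝ ∞ fun z : EuclideanSpace ℝ (Fin 4) × ℝ => z.1 i := fun i =>
    (contDiff_piLp_apply 2).comp contDiff_fst
  intro i
  fin_cases i <;> simp only [chainField] <;> simp
  · exact contDiff_const
  · exact contDiff_const.mul (h 0)
  · exact contDiff_const.mul (h 1)
  · exact contDiff_const.mul (contDiff_snd.pow 2)

/-- The order conditions of linear chains and of the bushy tree with two leaves, for all ways of
distributing the nodes over the explicit and the implicit method. -/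
theorem HasOrder.conditions {r p : ℕ} {M : IMEXMethod r} (hM : M.HasOrder p) (w : Fin 4 → ℝ)
    (a : Fin 4 → Fin r → Fin r → ℝ)
    (ha : ∀ i j k, a i j k = w i * M.A j k + (1 - w i) * M.Ahat j k)
    (d : Fin 4 → Fin r → ℝ) (hd : ∀ i k, d i k = w i * M.b k + (1 - w i) * M.bhat k) :
    (1 ≤ p → ∑ k, d 0 k = 1) ∧
    (2 ≤ p → ∑ k, d 1 k * ∑ l, a 0 k l = 1 / 2) ∧
    (3 ≤ p → ∑ k, d 2 k * ∑ l, a 1 k l * ∑ m, a 0 l m = 1 / 6) ∧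
    (3 ≤ p → ∑ k, (w 3 * M.b k * M.c k ^ 2 + (1 - w 3) * M.bhat k * M.chat k ^ 2) = 1 / 3) := by
  -- Triangularity of the field lets the stage equations be solved in closed form: each `v` is built
  -- from the previous one, apart from `v₃`, which depends on time only.
  set v₀ : Fin r → ℝ := fun k => ∑ l, a 0 k l with hv₀
  set v₁ : Fin r → ℝ := fun k => ∑ l, a 1 k l * v₀ l with hv₁
  set v₂ : Fin r → ℝ := fun k => ∑ l, a 2 k l * v₁ l with hv₂
  set v₃ : Fin r → ℝ := fun k =>
    ∑ l, (w 3 * M.A k l * M.c l ^ 2 + (1 - w 3) * M.Ahat k l * M.chat l ^ 2) with hv₃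
  set x : ℝ → EuclideanSpace ℝ (Fin 4) := fun t => !₂[t, t ^ 2 / 2, t ^ 3 / 6, t ^ 3 / 3] with hx
  set g : ℝ → Fin r → EuclideanSpace ℝ (Fin 4) := fun h k =>
    !₂[h * v₀ k, h ^ 2 * v₁ k, h ^ 3 * v₂ k, h ^ 3 * v₃ k] with hg
  have hx0 : x 0 = 0 := by ext i; fin_cases i <;> simp [hx]
  have hderiv : ∀ t, HasDerivAt x (chainField w (x t, t) + chainField (1 - w) (x t, t)) t := by
    intro t
    have hpi : HasDerivAt (fun t => (x t).ofLp)
        (chainField w (x t, t) + chainField (1 - w) (x t, t)).ofLp t := by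
      rw [hasDerivAt_pi]
      intro i
      fin_cases i <;> simp [hx, chainField]
      · exact hasDerivAt_id t
      · refine ((hasDerivAt_pow 2 t).div_const 2).congr_deriv ?_
        norm_num; ring
      · refine ((hasDerivAt_pow 3 t).div_const 6).congr_deriv ?_
        norm_num; ring
      · refine ((hasDerivAt_pow 3 t).div_const 3).congr_deriv ?_
        norm_num; ring
    exact ((PiLp.continuousLinearEquiv 2 ℝ fun _ : Fin 4 => ℝ).symm.toContinuousLinearMap.hasFDerivAt
      (x := (x t).ofLp)).comp_hasDerivAt t hpi
  have hgt : ∀ j, Tendsto (fun h => g h j) (𝓝[>] 0) (𝓝 (x 0)) := by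
    intro j
    have hcont : Continuous fun h => g h j := by
      refine (PiLp.continuous_toLp 2 _).comp (continuous_pi fun i => ?_)
      fin_cases i <;> simp <;> fun_prop
    refine (hcont.tendsto' 0 _ ?_).mono_left nhdsWithin_le_nhds
    ext i; fin_cases i <;> simp [hx, hg]
  -- Arbitrary rows `B`, `B'` cover both uses: the matrix rows for the stages and the weights for
  -- the step.
  have hinc : ∀ (B B' : Fin r → ℝ) (h : ℝ),
      h • ∑ k, (B k • chainField w (g h k, 0 + M.c k * h)
        + B' k • chainField (1 - w) (g h k, 0 + M.chat k * h))
      = !₂[h * ∑ k, (w 0 * B k + (1 - w 0) * B' k),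
          h ^ 2 * ∑ k, (w 1 * B k + (1 - w 1) * B' k) * v₀ k,
          h ^ 3 * ∑ k, (w 2 * B k + (1 - w 2) * B' k) * v₁ k,
          h ^ 3 * ∑ k, (w 3 * B k * M.c k ^ 2 + (1 - w 3) * B' k * M.chat k ^ 2)] := by
    intro B B' h
    ext i
    fin_cases i <;>
    · simp only [hg, chainField, PiLp.smul_apply, PiLp.add_apply, WithLp.ofLp_sum,
        Finset.sum_apply, smul_eq_mul, Finset.mul_sum]
      refine Finset.sum_congr rfl fun k _ => ?_
      simp [-mul_eq_mul_left_iff]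
      ring
  have hst : ∀ h, M.IsStages (chainField w) (chainField (1 - w)) 0 (x 0) h (g h) := by
    intro h j
    rw [hx0, zero_add, hinc (fun k => M.A j k) (fun k => M.Ahat j k)]
    simp only [hg, hv₀, hv₁, hv₂, hv₃, ha]
  have key := hM 4 (chainField w) (chainField (1 - w)) (contDiff_chainField _)
    (contDiff_chainField _) 0 x (.of_forall hderiv) g hgt (.of_forall hst)
  have hcoord : ∀ i, (fun h => (M.step (chainField w) (chainField (1 - w)) 0 (x 0) h (g h)) i
      - x (0 + h) i) =O[𝓝[>] 0] fun h => h ^ (p + 1) := fun i =>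
    ((EuclideanSpace.proj (𝕜 := ℝ) i).isBigO_comp _ _).trans key
  have hstep : ∀ h, M.step (chainField w) (chainField (1 - w)) 0 (x 0) h (g h)
      = !₂[h * ∑ k, d 0 k, h ^ 2 * ∑ k, d 1 k * v₀ k, h ^ 3 * ∑ k, d 2 k * v₁ k,
          h ^ 3 * ∑ k, (w 3 * M.b k * M.c k ^ 2 + (1 - w 3) * M.bhat k * M.chat k ^ 2)] := by
    intro h
    rw [step, hx0, zero_add, hinc]
    simp only [hd]
  simp only [hstep, zero_add] at hcoord
  simp only [hx] at hcoord
  refine ⟨fun hp => ?_, fun hp => ?_, fun hp => ?_, fun hp => ?_⟩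
  · refine sub_eq_zero.1 (eq_zero_of_pow_mul_isBigO hp ((hcoord 0).congr_left fun h => ?_))
    simp only [Matrix.cons_val]
    ring
  · refine sub_eq_zero.1 (eq_zero_of_pow_mul_isBigO hp ((hcoord 1).congr_left fun h => ?_))
    simp only [Matrix.cons_val]
    ring
  · refine sub_eq_zero.1 (eq_zero_of_pow_mul_isBigO hp ((hcoord 2).congr_left fun h => ?_))
    simp only [Matrix.cons_val]
    ring
  · refine sub_eq_zero.1 (eq_zero_of_pow_mul_isBigO hp ((hcoord 3).congr_left fun h => ?_))
    simp only [Matrix.cons_val]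
    ring

theorem HasOrder.conditions_two {r p : ℕ} {M : IMEXMethod r} (hM : M.HasOrder p) (hp : 2 ≤ p) :
    (∑ k, M.b k = 1) ∧ (∑ k, M.bhat k = 1) ∧
    (∑ k, M.b k * ∑ l, M.A k l = 1 / 2) ∧ (∑ k, M.b k * ∑ l, M.Ahat k l = 1 / 2) ∧
    (∑ k, M.bhat k * ∑ l, M.A k l = 1 / 2) ∧ (∑ k, M.bhat k * ∑ l, M.Ahat k l = 1 / 2) := by
  -- An entry `1` of `w` selects the explicit method and `0` the implicit one. The indices of a
  -- chain run from the innermost sum outwards, so `w 0` governs the innermost matrix and the last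
  -- index used governs the weights.
  have H := fun w => hM.conditions w (fun i j k => _) (fun _ _ _ => rfl) (fun i k => _)
    fun _ _ => rfl
  have hp1 : 1 ≤ p := by omega
  refine ⟨?_, ?_, ?_, ?_, ?_, ?_⟩
  · simpa using (H ![1, 1, 1, 1]).1 hp1
  · simpa using (H ![0, 1, 1, 1]).1 hp1
  · simpa using (H ![1, 1, 1, 1]).2.1 hp
  · simpa using (H ![0, 1, 1, 1]).2.1 hp
  · simpa using (H ![1, 0, 1, 1]).2.1 hp
  · simpa using (H ![0, 0, 1, 1]).2.1 hp

theorem HasOrder.conditions_three {r p : ℕ} {M : IMEXMethod r} (hM : M.HasOrder p) (hp : 3 ≤ p) :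
    (∑ k, M.b k * M.c k ^ 2 = 1 / 3) ∧ (∑ k, M.bhat k * M.chat k ^ 2 = 1 / 3) ∧
    (∑ k, M.b k * ∑ l, M.A k l * ∑ m, M.A l m = 1 / 6) ∧
    (∑ k, M.b k * ∑ l, M.A k l * ∑ m, M.Ahat l m = 1 / 6) ∧
    (∑ k, M.b k * ∑ l, M.Ahat k l * ∑ m, M.A l m = 1 / 6) ∧
    (∑ k, M.b k * ∑ l, M.Ahat k l * ∑ m, M.Ahat l m = 1 / 6) := by
  have H := fun w => hM.conditions w (fun i j k => _) (fun _ _ _ => rfl) (fun i k => _)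
    fun _ _ => rfl
  refine ⟨?_, ?_, ?_, ?_, ?_, ?_⟩
  · simpa using (H ![1, 1, 1, 1]).2.2.2 hp
  · simpa using (H ![1, 1, 1, 0]).2.2.2 hp
  · simpa using (H ![1, 1, 1, 1]).2.2.1 hp
  · simpa using (H ![0, 1, 1, 1]).2.2.1 hp
  · simpa using (H ![1, 0, 1, 1]).2.2.1 hp
  · simpa using (H ![0, 0, 1, 1]).2.2.1 hp

end IMEXMethod

/-! ### Row sums of the tableau of the family -/

theorem entry_of_nonpos {m : ℕ} (v : Fin m → ℝ) {k : ℤ} (hk : k ≤ 0) : entry v k = 0 :=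
  dif_neg (by omega)

theorem entry_of_lt {m : ℕ} (v : Fin m → ℝ) {k : ℤ} (hk : m < k) : entry v k = 0 :=
  dif_neg (by omega)

namespace IMEXCoeffs

variable {q : ℕ} (C : IMEXCoeffs q)

/-- The truncated `j - 1` makes the formula valid for `j = 0` too, where both entries vanish. For `j
= 1` the two columns coincide, but `β` at index `0` is zero, so nothing is counted twice. -/
theorem sum_A_mul (f : Fin (q + 1) → ℝ) {j j' : Fin (q + 1)} (hj : (j' : ℕ) = j - 1) :
    ∑ k, C.A j k * f k = entry C.α j * f j' + entry C.β (j - 1) * f 0 := by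
  have hterm : ∀ k, C.A j k * f k = (if k = j' then entry C.α j * f k else 0)
      + if k = 0 then entry C.β (j - 1) * f k else 0 := by
    intro k
    simp only [A, Fin.ext_iff, hj, Fin.val_zero]
    rcases Nat.eq_zero_or_pos (j : ℕ) with h0 | h0
    · simp [h0, entry_of_nonpos]
    · have h1 : (k : ℕ) + 1 = j ↔ (k : ℕ) = j - 1 := by omega
      by_cases hk : (k : ℕ) = j - 1
      · by_cases hk0 : (k : ℕ) = 0
        · rw [if_pos (h1.2 hk), if_pos hk, if_pos hk0, entry_of_nonpos C.β (by omega)]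
          ring
        · rw [if_pos (h1.2 hk), if_pos hk, if_neg hk0, add_zero]
      · simp [h1, hk]
  simp [hterm, Finset.sum_add_distrib]

theorem sum_Ahat_mul (f : Fin (q + 1) → ℝ) {j j' : Fin (q + 1)} (hj : (j' : ℕ) = j - 1) :
    ∑ k, C.Ahat j k * f k
      = entry C.dhat j * f j + entry C.αhat j * f j' + entry C.βhat (j - 1) * f 0 := by
  have hterm : ∀ k, C.Ahat j k * f k = (if k = j then entry C.dhat j * f k else 0)
      + (if k = j' then entry C.αhat j * f k else 0)
      + if k = 0 then entry C.βhat (j - 1) * f k else 0 := by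
    intro k
    simp only [Ahat, Fin.ext_iff, hj, Fin.val_zero]
    rcases Nat.eq_zero_or_pos (j : ℕ) with h0 | h0
    · simp [h0, entry_of_nonpos]
    · have h1 : (k : ℕ) + 1 = j ↔ (k : ℕ) = j - 1 := by omega
      by_cases hkj : (k : ℕ) = j
      · rw [if_pos hkj, if_pos hkj, if_neg (by omega), if_neg (by omega), add_zero, add_zero]
      by_cases hk : (k : ℕ) = j - 1
      · by_cases hk0 : (k : ℕ) = 0
        · rw [if_neg hkj, if_neg hkj, if_pos (h1.2 hk), if_pos hk, if_pos hk0,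
            entry_of_nonpos C.βhat (by omega)]
          ring
        · rw [if_neg hkj, if_neg hkj, if_pos (h1.2 hk), if_pos hk, if_neg hk0, add_zero, zero_add]
      · simp [h1, hk, hkj]
  simp [hterm, Finset.sum_add_distrib]

theorem sum_A (j : Fin (q + 1)) : ∑ k, C.A j k = entry C.α j + entry C.β (j - 1) := by
  simpa using C.sum_A_mul (fun _ => 1) (j := j) (j' := ⟨j - 1, by omega⟩) rfl

theorem sum_Ahat (j : Fin (q + 1)) :
    ∑ k, C.Ahat j k = entry C.dhat j + entry C.αhat j + entry C.βhat (j - 1) := by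
  simpa using C.sum_Ahat_mul (fun _ => 1) (j := j) (j' := ⟨j - 1, by omega⟩) rfl

theorem sum_A_zero : ∑ k, C.A 0 k = 0 := by
  simp [sum_A, entry_of_nonpos]

theorem sum_Ahat_zero : ∑ k, C.Ahat 0 k = 0 := by
  simp [sum_Ahat, entry_of_nonpos]

theorem sum_A_zero_mul (f : Fin (q + 1) → ℝ) : ∑ k, C.A 0 k * f k = 0 := by
  simp [C.sum_A_mul f (j := 0) (j' := 0) rfl, entry_of_nonpos]

theorem sum_Ahat_zero_mul (f : Fin (q + 1) → ℝ) : ∑ k, C.Ahat 0 k * f k = 0 := by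
  simp [C.sum_Ahat_mul f (j := 0) (j' := 0) rfl, entry_of_nonpos]

theorem A_last_eq_zero {k : Fin (q + 1)} (h0 : k ≠ 0) (h1 : (k : ℕ) ≠ q - 1) :
    C.A (Fin.last q) k = 0 := by
  have h0' : (k : ℕ) ≠ 0 := fun h => h0 (Fin.ext h)
  rw [A, if_neg (by simp only [Fin.val_last]; omega), if_neg h0']

theorem Ahat_last_eq (hq : 1 ≤ q) (hα : entry C.αhat q = entry C.α q)
    (hβ : entry C.βhat (q - 1) = entry C.β (q - 1)) :
    C.Ahat (Fin.last q) = C.A (Fin.last q) := by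
  funext k
  simp only [Ahat, A, Fin.val_last, hα, hβ]
  by_cases hk : (k : ℕ) = q
  · rw [if_pos hk, if_neg (by omega), if_neg (by omega), entry_of_lt _ (by omega)]
  · rw [if_neg hk]

theorem eq_of_b_ne_zero {k : Fin (q + 1)} (hk : C.toMethod.b k ≠ 0) :
    k = 0 ∨ k = ⟨q - 1, by omega⟩ := by
  by_contra! hcon
  exact hk (C.A_last_eq_zero hcon.1 fun h => hcon.2 (Fin.ext h))

theorem sum_A_last_mul (f : Fin (q + 1) → ℝ) :
    ∑ k, C.A (Fin.last q) k * f k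
      = entry C.α q * f ⟨q - 1, by omega⟩ + entry C.β (q - 1) * f 0 := by
  simpa using C.sum_A_mul f (j := Fin.last q) (j' := ⟨q - 1, by omega⟩) rfl

theorem sum_Ahat_last_mul (hq : 2 ≤ q) (f : Fin (q + 1) → ℝ) :
    ∑ k, C.Ahat (Fin.last q) k * f k
      = entry C.αhat q * f ⟨q - 1, by omega⟩ + entry C.βhat (q - 1) * f 0 := by
  have hd : entry C.dhat q = 0 := entry_of_lt _ (by omega)
  simpa [hd] using C.sum_Ahat_mul f (j := Fin.last q) (j' := ⟨q - 1, by omega⟩) rfl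

theorem sum_A_sub_one_mul (hq : 2 ≤ q) (f : Fin (q + 1) → ℝ) :
    ∑ k, C.A ⟨q - 1, by omega⟩ k * f k
      = entry C.α (q - 1) * f ⟨q - 2, by omega⟩ + entry C.β (q - 2) * f 0 := by
  -- Row numbers use natural subtraction, indices of `entry` integer subtraction; they agree because
  -- `2 ≤ q`.
  have hz : ((q - 1 : ℕ) : ℤ) = q - 1 := by omega
  have h := C.sum_A_mul f (j := ⟨q - 1, by omega⟩) (j' := ⟨q - 2, by omega⟩) (by simp only; omega)
  rwa [hz, sub_sub] at h

theorem sum_Ahat_sub_one_mul (hq : 2 ≤ q) (f : Fin (q + 1) → ℝ) :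
    ∑ k, C.Ahat ⟨q - 1, by omega⟩ k * f k
      = entry C.dhat (q - 1) * f ⟨q - 1, by omega⟩ + entry C.αhat (q - 1) * f ⟨q - 2, by omega⟩ + entry C.βhat (q - 2) * f 0 := by
  have hz : ((q - 1 : ℕ) : ℤ) = q - 1 := by omega
  have h := C.sum_Ahat_mul f (j := ⟨q - 1, by omega⟩) (j' := ⟨q - 2, by omega⟩) (by simp only; omega)
  rwa [hz, sub_sub] at h

theorem sum_A_sub_one (hq : 2 ≤ q) :
    ∑ k, C.A ⟨q - 1, by omega⟩ k
      = entry C.α (q - 1) + entry C.β (q - 2) := by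
  have hz : ((q - 1 : ℕ) : ℤ) = q - 1 := by omega
  have h := C.sum_A ⟨q - 1, by omega⟩
  rwa [hz, sub_sub] at h

theorem sum_Ahat_sub_one (hq : 2 ≤ q) :
    ∑ k, C.Ahat ⟨q - 1, by omega⟩ k
      = entry C.dhat (q - 1) + entry C.αhat (q - 1) + entry C.βhat (q - 2) := by
  have hz : ((q - 1 : ℕ) : ℤ) = q - 1 := by omega
  have h := C.sum_Ahat ⟨q - 1, by omega⟩
  rwa [hz, sub_sub] at h

theorem sum_A_sub_two (hq : 2 ≤ q) :
    ∑ k, C.A ⟨q - 2, by omega⟩ k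
      = entry C.α (q - 2) + entry C.β (q - 3) := by
  have hz : ((q - 2 : ℕ) : ℤ) = q - 2 := by omega
  have h := C.sum_A ⟨q - 2, by omega⟩
  rwa [hz, sub_sub] at h

theorem sum_Ahat_sub_two (hq : 2 ≤ q) :
    ∑ k, C.Ahat ⟨q - 2, by omega⟩ k
      = entry C.dhat (q - 2) + entry C.αhat (q - 2) + entry C.βhat (q - 3) := by
  have hz : ((q - 2 : ℕ) : ℤ) = q - 2 := by omega
  have h := C.sum_Ahat ⟨q - 2, by omega⟩
  rwa [hz, sub_sub] at h

/-! ### Order conditions for the family -/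

theorem conditions_of_hasOrder_two (hq : 2 ≤ q) (h : C.toMethod.HasOrder 2) :
    (entry C.α q * (entry C.β (q - 2) + entry C.α (q - 1)) = 1 / 2 ∧
        entry C.α q * (entry C.βhat (q - 2) + entry C.αhat (q - 1) + entry C.dhat (q - 1))
          = 1 / 2 ∧
        entry C.αhat q * (entry C.βhat (q - 2) + entry C.αhat (q - 1) + entry C.dhat (q - 1))
          = 1 / 2 ∧
        entry C.αhat q * (entry C.β (q - 2) + entry C.α (q - 1)) = 1 / 2 ∧
        entry C.α q + entry C.β (q - 1) = 1 ∧
        entry C.αhat q + entry C.βhat (q - 1) = 1) := by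
  have hb := C.sum_A_last_mul
  have hc0 := C.sum_A_zero
  have hchat0 := C.sum_Ahat_zero
  have hc1 := C.sum_A_sub_one hq
  have hchat1 := C.sum_Ahat_sub_one hq
  have hbhat := C.sum_Ahat_last_mul hq
  have hb1 := hb fun _ => 1
  have hbhat1 := hbhat fun _ => 1
  simp only [mul_one] at hb1 hbhat1
  obtain ⟨e1, e2, e3, e4, e5, e6⟩ := h.conditions_two le_rfl
  simp only [IMEXCoeffs.toMethod] at e1 e2 e3 e4 e5 e6
  simp only [hb, hbhat, hb1, hbhat1, hc0, hchat0, hc1, hchat1, mul_zero, add_zero]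
    at e1 e2 e3 e4 e5 e6
  exact ⟨by linarith, by linarith, by linarith, by linarith, e1, e2⟩

theorem hasOrder_two_of_conditions (hq : 2 ≤ q) (h :
    (entry C.α q * (entry C.β (q - 2) + entry C.α (q - 1)) = 1 / 2 ∧
        entry C.α q * (entry C.βhat (q - 2) + entry C.αhat (q - 1) + entry C.dhat (q - 1))
          = 1 / 2 ∧
        entry C.αhat q * (entry C.βhat (q - 2) + entry C.αhat (q - 1) + entry C.dhat (q - 1))
          = 1 / 2 ∧
        entry C.αhat q * (entry C.β (q - 2) + entry C.α (q - 1)) = 1 / 2 ∧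
        entry C.α q + entry C.β (q - 1) = 1 ∧
        entry C.αhat q + entry C.βhat (q - 1) = 1)) :
    C.toMethod.HasOrder 2 := by
  have hb := C.sum_A_last_mul
  have hc0 := C.sum_A_zero
  have hchat0 := C.sum_Ahat_zero
  have hc1 := C.sum_A_sub_one hq
  have hchat1 := C.sum_Ahat_sub_one hq
  obtain ⟨e1, e2, e3, e4, e5, e6⟩ := h
  have hα0 : entry C.α q ≠ 0 := fun h => by norm_num [h] at e1
  -- The products equal to `1 / 2` have nonzero factors. Cancelling them identifies the two nodes of
  -- stage `q - 1`, and below the two weights, so the general criterion applies.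
  have hcc := mul_left_cancel₀ hα0 (e1.trans e2.symm)
  have hcne : entry C.β (q - 2) + entry C.α (q - 1) ≠ 0 := fun h => by norm_num [h] at e1
  have hαα := mul_right_cancel₀ hcne (e4.trans e1.symm)
  refine C.toMethod.hasOrder_two (fun _ => rfl) (fun _ => rfl)
    (C.Ahat_last_eq (by omega) hαα (by linarith)) ?_ ?_
  · intro i hi
    simp only [IMEXCoeffs.toMethod]
    interval_cases i <;> simp only [pow_zero, pow_one, hb, hc0, hc1] <;> norm_num <;> linarith
  · intro k hk
    rcases C.eq_of_b_ne_zero hk with rfl | rfl <;> simp only [IMEXCoeffs.toMethod]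
    · rw [hc0, hchat0]
    · rw [hc1, hchat1]; linarith

theorem conditions_of_hasOrder_three (hq : 2 ≤ q) (h : C.toMethod.HasOrder 3) :
    (entry C.α q = 3 / 4 ∧ entry C.αhat q = 3 / 4 ∧
        entry C.β (q - 1) = 1 / 4 ∧ entry C.βhat (q - 1) = 1 / 4 ∧
        entry C.αhat (q - 1) * (entry C.αhat (q - 2) + entry C.dhat (q - 2)
          + entry C.βhat (q - 3)) + 2 * entry C.dhat (q - 1) / 3 = 2 / 9 ∧
        entry C.αhat (q - 1) * (entry C.α (q - 2) + entry C.β (q - 3))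
          + 2 * entry C.dhat (q - 1) / 3 = 2 / 9 ∧
        entry C.α (q - 1) * (entry C.αhat (q - 2) + entry C.dhat (q - 2)
          + entry C.βhat (q - 3)) = 2 / 9 ∧
        entry C.α (q - 1) * (entry C.α (q - 2) + entry C.β (q - 3)) = 2 / 9 ∧
        entry C.αhat (q - 1) + entry C.dhat (q - 1) + entry C.βhat (q - 2) = 2 / 3 ∧
        entry C.α (q - 1) + entry C.β (q - 2) = 2 / 3) := by
  have hb := C.sum_A_last_mul
  have hc0 := C.sum_A_zero
  have hchat0 := C.sum_Ahat_zero
  have hc1 := C.sum_A_sub_one hq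
  have hchat1 := C.sum_Ahat_sub_one hq
  have hA := C.sum_A_sub_one_mul hq
  have hAhat := C.sum_Ahat_sub_one_mul hq
  have hc2 := C.sum_A_sub_two hq
  have hchat2 := C.sum_Ahat_sub_two hq
  have hbhat := C.sum_Ahat_last_mul hq
  have hb1 := hb fun _ => 1
  have hbhat1 := hbhat fun _ => 1
  simp only [mul_one] at hb1 hbhat1
  obtain ⟨e1, e2, e3, e4, e5, e6⟩ := h.conditions_two (by norm_num)
  obtain ⟨f1, f2, f3, f4, f5, f6⟩ := h.conditions_three le_rfl
  simp only [IMEXCoeffs.toMethod] at e1 e2 e3 e4 e5 e6 f1 f2 f3 f4 f5 f6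
  simp only [hb, hbhat, hb1, hbhat1, hA, hAhat, C.sum_A_zero_mul, C.sum_Ahat_zero_mul, hc0,
    hchat0, hc1, hchat1, hc2, hchat2, mul_zero, add_zero, ne_eq, OfNat.ofNat_ne_zero,
    not_false_eq_true, zero_pow] at e1 e2 e3 e4 e5 e6 f1 f2 f3 f4 f5 f6
  -- With `c` the node of stage `q - 1`, `α_q c = 1/2` and `α_q c ^ 2 = 1/3` give `c = 2/3`, hence
  -- `α_q = 3/4`; likewise for the implicit method.
  have hc : entry C.α (q - 1) + entry C.β (q - 2) = 2 / 3 := by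
    linear_combination 2 * f1 - 2 * (entry C.α (q - 1) + entry C.β (q - 2)) * e3
  have hchat : entry C.dhat (q - 1) + entry C.αhat (q - 1) + entry C.βhat (q - 2) = 2 / 3 := by
    linear_combination 2 * f2
      - 2 * (entry C.dhat (q - 1) + entry C.αhat (q - 1) + entry C.βhat (q - 2)) * e6
  rw [hc] at e3 f5
  rw [hchat] at e6 f6
  have hα : entry C.α q = 3 / 4 := by linarith
  have hαhat : entry C.αhat q = 3 / 4 := by linarith
  rw [hα] at e1 f3 f4 f5 f6
  rw [hαhat] at e2
  exact ⟨hα, hαhat, by linarith, by linarith, by linarith, by linarith, by linarith,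
    by linarith, by linarith, hc⟩

theorem hasOrder_three_of_conditions (hq : 2 ≤ q) (h :
    (entry C.α q = 3 / 4 ∧ entry C.αhat q = 3 / 4 ∧
        entry C.β (q - 1) = 1 / 4 ∧ entry C.βhat (q - 1) = 1 / 4 ∧
        entry C.αhat (q - 1) * (entry C.αhat (q - 2) + entry C.dhat (q - 2)
          + entry C.βhat (q - 3)) + 2 * entry C.dhat (q - 1) / 3 = 2 / 9 ∧
        entry C.αhat (q - 1) * (entry C.α (q - 2) + entry C.β (q - 3))
          + 2 * entry C.dhat (q - 1) / 3 = 2 / 9 ∧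
        entry C.α (q - 1) * (entry C.αhat (q - 2) + entry C.dhat (q - 2)
          + entry C.βhat (q - 3)) = 2 / 9 ∧
        entry C.α (q - 1) * (entry C.α (q - 2) + entry C.β (q - 3)) = 2 / 9 ∧
        entry C.αhat (q - 1) + entry C.dhat (q - 1) + entry C.βhat (q - 2) = 2 / 3 ∧
        entry C.α (q - 1) + entry C.β (q - 2) = 2 / 3)) :
    C.toMethod.HasOrder 3 := by
  have hb := C.sum_A_last_mul
  have hc0 := C.sum_A_zero
  have hchat0 := C.sum_Ahat_zero
  have hc1 := C.sum_A_sub_one hq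
  have hchat1 := C.sum_Ahat_sub_one hq
  have hA := C.sum_A_sub_one_mul hq
  have hAhat := C.sum_Ahat_sub_one_mul hq
  have hc2 := C.sum_A_sub_two hq
  have hchat2 := C.sum_Ahat_sub_two hq
  obtain ⟨e1, e2, e3, e4, e5, e6, e7, e8, e9, e10⟩ := h
  refine C.toMethod.hasOrder_three (fun _ => rfl) (fun _ => rfl)
    (C.Ahat_last_eq (by omega) (e2.trans e1.symm) (e4.trans e3.symm)) ?_ ?_ ?_ ?_ ?_ ?_
  · intro i hi
    simp only [IMEXCoeffs.toMethod]
    interval_cases i <;> simp only [pow_zero, pow_one, hb, hc0, hc1, e1, e3, e10] <;> norm_num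
  -- Stage `0` is exact, so its conditions are trivial. At stage `q - 1` the required value `c ^ 2 /
  -- 2` is `2 / 9`, the constant in the hypotheses.
  all_goals
    intro k hk
    rcases C.eq_of_b_ne_zero hk with rfl | rfl <;> simp only [IMEXCoeffs.toMethod]
  · rw [hc0, hchat0]
  · rw [hc1, hchat1]; linarith
  · rw [C.sum_A_zero_mul, hc0]; norm_num
  · rw [hA, hc0, hc1, hc2, e10]; linarith
  · rw [C.sum_A_zero_mul, hc0]; norm_num
  · rw [hA, hchat0, hc1, hchat2, e10]; linarith
  · rw [C.sum_Ahat_zero_mul, hc0]; norm_num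
  · rw [hAhat, hc0, hc1, hc2, e10]; linarith
  · rw [C.sum_Ahat_zero_mul, hc0]; norm_num
  · rw [hAhat, hchat0, hchat1, hc1, hchat2, e10]
    rw [show entry C.dhat (q - 1) + entry C.αhat (q - 1) + entry C.βhat (q - 2) = 2 / 3 by
      linarith]
    linarith

end IMEXCoeffs

theorem theorem3p1 (q : ℕ) (hq : 2 ≤ q) (C : IMEXCoeffs q) :
    -- second order
    (C.toMethod.HasOrder 2 ↔
      (entry C.α q * (entry C.β (q - 2) + entry C.α (q - 1)) = 1 / 2 ∧
        entry C.α q * (entry C.βhat (q - 2) + entry C.αhat (q - 1) + entry C.dhat (q - 1))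
          = 1 / 2 ∧
        entry C.αhat q * (entry C.βhat (q - 2) + entry C.αhat (q - 1) + entry C.dhat (q - 1))
          = 1 / 2 ∧
        entry C.αhat q * (entry C.β (q - 2) + entry C.α (q - 1)) = 1 / 2 ∧
        entry C.α q + entry C.β (q - 1) = 1 ∧
        entry C.αhat q + entry C.βhat (q - 1) = 1)) ∧
    -- second order with vanishing `β`s
    (entry C.β (q - 1) = 0 → entry C.βhat (q - 1) = 0 →
      entry C.β (q - 2) = 0 → entry C.βhat (q - 2) = 0 →
      ((entry C.α q * (entry C.β (q - 2) + entry C.α (q - 1)) = 1 / 2 ∧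
        entry C.α q * (entry C.βhat (q - 2) + entry C.αhat (q - 1) + entry C.dhat (q - 1))
          = 1 / 2 ∧
        entry C.αhat q * (entry C.βhat (q - 2) + entry C.αhat (q - 1) + entry C.dhat (q - 1))
          = 1 / 2 ∧
        entry C.αhat q * (entry C.β (q - 2) + entry C.α (q - 1)) = 1 / 2 ∧
        entry C.α q + entry C.β (q - 1) = 1 ∧
        entry C.αhat q + entry C.βhat (q - 1) = 1) ↔
      (entry C.α q = 1 ∧ entry C.αhat q = 1 ∧ entry C.α (q - 1) = 1 / 2 ∧
        entry C.αhat (q - 1) + entry C.dhat (q - 1) = 1 / 2))) ∧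
    -- third order
    (C.toMethod.HasOrder 3 ↔
      (entry C.α q = 3 / 4 ∧ entry C.αhat q = 3 / 4 ∧
        entry C.β (q - 1) = 1 / 4 ∧ entry C.βhat (q - 1) = 1 / 4 ∧
        entry C.αhat (q - 1) * (entry C.αhat (q - 2) + entry C.dhat (q - 2)
          + entry C.βhat (q - 3)) + 2 * entry C.dhat (q - 1) / 3 = 2 / 9 ∧
        entry C.αhat (q - 1) * (entry C.α (q - 2) + entry C.β (q - 3))
          + 2 * entry C.dhat (q - 1) / 3 = 2 / 9 ∧
        entry C.α (q - 1) * (entry C.αhat (q - 2) + entry C.dhat (q - 2)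
          + entry C.βhat (q - 3)) = 2 / 9 ∧
        entry C.α (q - 1) * (entry C.α (q - 2) + entry C.β (q - 3)) = 2 / 9 ∧
        entry C.αhat (q - 1) + entry C.dhat (q - 1) + entry C.βhat (q - 2) = 2 / 3 ∧
        entry C.α (q - 1) + entry C.β (q - 2) = 2 / 3)) := by
  refine ⟨⟨C.conditions_of_hasOrder_two hq, C.hasOrder_two_of_conditions hq⟩,
    fun h1 h2 h3 h4 => ?_,
    ⟨C.conditions_of_hasOrder_three hq, C.hasOrder_three_of_conditions hq⟩⟩
  simp only [h1, h2, h3, h4, zero_add, add_zero]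
  constructor
  · rintro ⟨e1, e2, -, -, e5, e6⟩
    rw [e5, one_mul] at e1 e2
    exact ⟨e5, e6, e1, e2⟩
  · rintro ⟨e1, e2, e3, e4⟩
    simp only [e1, e2, e3, e4, one_mul, and_self]
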